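/- Let $n\ge 1$ and let $\ell_j=a_{1j}s+a_{2j}t\in\mathbb{R}[s,t]$, $j=1,\dots,n$, be non-zero linear forms with pairwise distinct roots in $\mathbb{P}^1$. Then any two binary forms $c_1,c_2\in\mathbb{R}[s,t]$ that are homogeneous of degree $n-1$ (the zero form included) can be written, in exactly one way, as $$c_1=\sum_{i=1}^n c_{1i}\prod_{j\ne i}\ell_j,\qquad c_2=\sum_{i=1}^n c_{2i}\prod_{j\ne i}\ell_j\qquad(c_{ij}\in\mathbb{R}).$$ Write $p_{ij}(a)=a_{1i}a_{2j}-a_{1j}a_{2i}$ and $p_{ij}(c)=c_{1i}c_{2j}-c_{1j}c_{2i}$ for $i<j$, for the $2\times2$ minors of the $2\times n$ matrices $a=(a_{ij})$ and $c=(c_{ij})$. Up to a non-zero constant that does not depend on $c$, the resultant of $c_1$ and $c_2$ equals $$\sum_{T\in\mathcal{T}_n}\ \prod_{\{i,j\}\in T}p_{ij}(c)\cdot\prod_{\{k,l\}\notin T}p_{kl}(a),$$ where $\mathcal{T}_n$ is the set of spanning trees of the complete graph on $\{1,\dots,n\}$ and all edges are written with $i<j$ and $k<l$. Precisely, let $\mathrm{Res}(c_1,c_2)$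 be the resultant of $c_1,c_2$ as binary forms of degree $n-1$ in $(s,t)$, i.e. the determinant of their $(2n-2)\times(2n-2)$ Sylvester matrix, with the usual normalization $\mathrm{Res}(s^{n-1},t^{n-1})=1$. Then $\prod_{k<l}p_{kl}(a)\neq 0$ and $$\mathrm{Res}(c_1,c_2)=(-1)^{\binom n2}\prod_{1\le k<l\le n}p_{kl}(a)\cdot\sum_{T\in\mathcal{T}_n}\ \prod_{\{i,j\}\in T}p_{ij}(c)\cdot\prod_{\{k,l\}\notin T}p_{kl}(a).$$ -/

import Mathlib

open MvPolynomial
open scoped LinearAlgebra.Projectivization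

noncomputable section

/-- The linear form `ℓ_j = a_{1j} s + a_{2j} t` in `ℝ[s, t]`; the variables are `s = X 0`,
`t = X 1`. -/
def linForm {n : ℕ} (a : Matrix (Fin 2) (Fin n) ℝ) (j : Fin n) : MvPolynomial (Fin 2) ℝ :=
  C (a 0 j) * X 0 + C (a 1 j) * X 1

/-- The point `p` of the projective line is a root of the binary form `F`.  For homogeneous `F`
this does not depend on the representative of `p`. -/
def IsProjRoot (F : MvPolynomial (Fin 2) ℝ) (p : ℙ ℝ (Fin 2 → ℝ)) : Prop :=
  eval p.rep F = 0

/-- The binary form `∑ i, c_i ∏_{j ≠ i} ℓ_j`. -/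
def interpForm {n : ℕ} (a : Matrix (Fin 2) (Fin n) ℝ) (c : Fin n → ℝ) :
    MvPolynomial (Fin 2) ℝ :=
  ∑ i, C (c i) * ∏ j ∈ Finset.univ.erase i, linForm a j

/-- The dehomogenization `F(x, 1)` of a binary form `F(s, t)`: the coefficient of `s ^ k t ^ (d - k)`
in a form of degree `d` becomes the coefficient of `x ^ k`. -/
def dehomog (F : MvPolynomial (Fin 2) ℝ) : Polynomial ℝ :=
  aeval ![Polynomial.X, 1] F

/-- The resultant of two binary forms of degrees `d` and `e`: the determinant of the
`(d + e) × (d + e)` Sylvester matrix of their coefficients.  The degrees are those of the forms,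
so that a common root at infinity `[1 : 0]` is taken into account. -/
def formResultant (F G : MvPolynomial (Fin 2) ℝ) (d e : ℕ) : ℝ :=
  Polynomial.resultant (dehomog F) (dehomog G) d e

/-- The minor of a `2 × n` matrix on the columns `i`, `j` (in this order). -/
def minor {n : ℕ} (M : Matrix (Fin 2) (Fin n) ℝ) (i j : Fin n) : ℝ :=
  (M.submatrix id ![i, j]).det

open Classical in
/-- The sum over the spanning trees `T` of the complete graph on `n` vertices of
`∏_{ij ∈ T} p_ij(c) ∏_{kl ∉ T} p_kl(a)`; an edge is listed as the pair of its ends in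
increasing order. -/
def spanningTreeSum {n : ℕ} (c a : Matrix (Fin 2) (Fin n) ℝ) : ℝ :=
  ∑ T : SimpleGraph (Fin n) with T.IsTree,
    (∏ e : Fin n × Fin n with e.1 < e.2 ∧ T.Adj e.1 e.2, minor c e.1 e.2) *
      ∏ e : Fin n × Fin n with e.1 < e.2 ∧ ¬ T.Adj e.1 e.2, minor a e.1 e.2

end

/-!
# The resultant of two binary forms as a sum over spanning trees

The Sylvester matrix consists of four triangular Toeplitz blocks, two of which commute, so its
determinant is, up to sign, that of the Bezout matrix
(`Polynomial.resultant_eq_det_bezoutMatrix`). The Bezout matrix is bilinear and alternating in the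
two forms. On two members `Q_i = ∏_{m ≠ i} ℓ_m` and `Q_j` of the interpolation basis it is
`-p_{ij}(a) q qᵀ`, where `q` is the coefficient vector of `∏_{m ≠ i, j} ℓ_m`, because `Q_i` and
`Q_j` are multiples of this form by `ℓ_j` and `ℓ_i` (`Polynomial.bezoutMatrix_linear_mul`). Hence
the Bezout matrix of `c_1` and `c_2` is `-∑_{i < j} w_{ij} h_{ij} h_{ij}ᵀ` with
`w_{ij} = p_{ij}(c) / p_{ij}(a)` and `h_{ij} = p_{ij}(a) q`.

By the Plücker relation `h_{ij} = h_i - h_j` for suitable potentials `h_i` on the vertices, with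
`h = 0` at a root vertex (`C_minor_mul_prod_eq_potential_sub`). So the Bezout matrix is `-Hᵀ L H`,
where `L` is the reduced Laplacian of the complete graph with weights `w_{ij}`
(`bezoutMatrix_dehomog_interpForm`). The determinant of `L` is a sum over spanning trees by the
matrix-tree theorem (`det_reducedLaplacian`, from the Cauchy–Binet formula), and
`(det H)² = ∏_{k < l} p_{kl}(a)²` by evaluating the interpolation basis at the roots of the `ℓ_j`,
which is multiplication by a projective Vandermonde matrix (`det_interpMatrix_sq`). The same
evaluation shows that the `Q_i` form a basis, which gives existence and uniqueness of `c`.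
-/

/-! ### The Cauchy–Binet formula and the weighted matrix-tree theorem -/

/-- The Cauchy–Binet formula. The sum over sets of columns is replaced by a sum over all families
of columns, which counts each set once for each of its orderings. -/
theorem Matrix.factorial_mul_det_mul {m E R : Type*} [Fintype m] [DecidableEq m] [Fintype E]
    [CommRing R] (A : Matrix m E R) (B : Matrix E m R) :
    ((Fintype.card m).factorial : R) * (A * B).det =
      ∑ p : m → E, (A.submatrix id p).det * (B.submatrix p id).det := by
  classical
  have key : (A * B).det = ∑ p : m → E, (A.submatrix id p).det * ∏ i, B (p i) i := by
    simp only [Matrix.det_apply', Matrix.mul_apply, Finset.prod_univ_sum, Finset.mul_sum,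
      Fintype.piFinset_univ, Finset.sum_mul, Matrix.submatrix_apply, id]
    rw [Finset.sum_comm]
    refine Finset.sum_congr rfl fun p _ ↦ Finset.sum_congr rfl fun σ _ ↦ ?_
    rw [Finset.prod_mul_distrib, mul_assoc]
  have h (σ : Equiv.Perm m) : ∑ p : m → E, (A.submatrix id p).det *
      (((Equiv.Perm.sign σ : ℤ) : R) * ∏ i, B (p (σ i)) i) = (A * B).det := by
    rw [key, ← Equiv.sum_comp (Equiv.arrowCongr σ (Equiv.refl E))]
    refine Finset.sum_congr rfl fun p _ ↦ ?_
    have : A.submatrix id (Equiv.arrowCongr σ (Equiv.refl E) p) =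
        (A.submatrix id p).submatrix id σ.symm := by ext; simp
    rw [this, Matrix.det_permute']
    have hs : ((Equiv.Perm.sign σ : ℤ) : R) * ((Equiv.Perm.sign σ : ℤ) : R) = 1 := by
      rw [← Int.cast_mul, ← Units.val_mul, Int.units_mul_self]
      simp
    simp only [Equiv.Perm.sign_symm, Equiv.arrowCongr_apply, Function.comp_apply,
      Equiv.symm_apply_apply, Equiv.refl_apply]
    linear_combination (A.submatrix id p).det * (∏ i, B (p i) i) * hs
  -- Expanding the second factor gives `(card m)!` copies of `key`, one for each permutation.
  simp only [Matrix.det_apply' (B.submatrix _ _), Finset.mul_sum, Matrix.submatrix_apply, id]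
  rw [Finset.sum_comm, Finset.sum_congr rfl fun σ _ ↦ h σ]
  simp [Fintype.card_perm]

/-- The pairs `(u, v)` with `u < v`, as an encoding of the edges of the complete graph on
`Fin n`. -/
abbrev OrderedPair (n : ℕ) : Type := {e : Fin n × Fin n // e.1 < e.2}

/-- The indicator vector of a vertex, with the coordinate of the vertex `0` left out. -/
def reducedIndicator {d : ℕ} (v : Fin (d + 1)) (k : Fin d) : ℤ := if v = k.succ then 1 else 0

/-- The incidence matrix of the complete graph on `Fin (d + 1)`, with the edges oriented from the
larger to the smaller end and the column of the vertex `0` removed. -/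
def reducedIncidence (d : ℕ) : Matrix (OrderedPair (d + 1)) (Fin d) ℤ :=
  .of fun e ↦ reducedIndicator e.1.1 - reducedIndicator e.1.2

/-- The graph whose edges are the values of a family of ordered pairs. -/
def graphOfPairs {n : ℕ} {ι : Type*} (p : ι → OrderedPair n) : SimpleGraph (Fin n) :=
  .fromRel fun u v ↦ ∃ i, (p i).1 = (u, v)

/-- The edges of a graph, as ordered pairs. -/
noncomputable def SimpleGraph.orderedPairs {n : ℕ} (G : SimpleGraph (Fin n)) :
    Finset (OrderedPair n) :=
  open Classical in Finset.univ.filter fun e ↦ G.Adj e.1.1 e.1.2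

theorem SimpleGraph.mem_orderedPairs {n : ℕ} {G : SimpleGraph (Fin n)} {e : OrderedPair n} :
    e ∈ G.orderedPairs ↔ G.Adj e.1.1 e.1.2 := by simp [orderedPairs]

theorem graphOfPairs_adj_iff {n : ℕ} {ι : Type*} (p : ι → OrderedPair n) (e : OrderedPair n) :
    (graphOfPairs p).Adj e.1.1 e.1.2 ↔ e ∈ Set.range p := by
  obtain ⟨⟨u, v⟩, h : u < v⟩ := e
  simp only [graphOfPairs, SimpleGraph.fromRel_adj, Set.mem_range]
  constructor
  · rintro ⟨-, ⟨i, hi⟩ | ⟨i, hi⟩⟩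
    · exact ⟨i, Subtype.ext hi⟩
    · have := (p i).2
      rw [hi] at this
      exact absurd this h.not_gt
  · rintro ⟨i, hi⟩
    exact ⟨h.ne, Or.inl ⟨i, by rw [hi]⟩⟩

theorem graphOfPairs_eq_iff {n : ℕ} {ι : Type*} (p : ι → OrderedPair n)
    (G : SimpleGraph (Fin n)) : graphOfPairs p = G ↔ Set.range p = G.orderedPairs := by
  constructor
  · rintro rfl
    ext e
    rw [Finset.mem_coe, SimpleGraph.mem_orderedPairs, graphOfPairs_adj_iff]
  · intro h
    have key (u v : Fin n) (huv : u < v) : (graphOfPairs p).Adj u v ↔ G.Adj u v := by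
      rw [graphOfPairs_adj_iff p ⟨(u, v), huv⟩, h, Finset.mem_coe, SimpleGraph.mem_orderedPairs]
    ext u v
    rcases lt_trichotomy u v with huv | rfl | huv
    · exact key u v huv
    · simp
    · rw [SimpleGraph.adj_comm, key v u huv, SimpleGraph.adj_comm]

theorem SimpleGraph.card_orderedPairs {n : ℕ} (G : SimpleGraph (Fin n)) :
    G.orderedPairs.card = Nat.card G.edgeSet := by
  classical
  rw [Nat.card_eq_fintype_card, ← SimpleGraph.edgeFinset_card]
  refine Finset.card_bij (fun e _ ↦ s(e.1.1, e.1.2)) ?_ ?_ ?_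
  · intro e he
    simpa [mem_orderedPairs] using he
  · rintro ⟨⟨a, b⟩, h : a < b⟩ - ⟨⟨a', b'⟩, h' : a' < b'⟩ - heq
    rcases Sym2.eq_iff.1 heq with ⟨h1, h2⟩ | ⟨h1, h2⟩
    · simp_all
    · simp only at h1 h2
      subst h1 h2
      exact absurd h h'.not_gt
  · intro b
    induction b with
    | _ u v =>
    intro hb
    have hb' : G.Adj u v := by simpa using hb
    rcases lt_or_gt_of_ne hb'.ne with huv | huv
    · exact ⟨⟨(u, v), huv⟩, mem_orderedPairs.2 hb', rfl⟩
    · exact ⟨⟨(v, u), huv⟩, mem_orderedPairs.2 hb'.symm, Sym2.eq_swap⟩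

/-- For a connected graph with root `0`, the indicator of each vertex is an integral combination
of the rows of the incidence matrix: follow a path to the root. So that matrix is invertible over
`ℤ`. -/
theorem det_reducedIncidence_sq_of_connected {d : ℕ} (p : Fin d → OrderedPair (d + 1))
    (h : (graphOfPairs p).Connected) : ((reducedIncidence d).submatrix p id).det ^ 2 = 1 := by
  let row (i : Fin d) : Fin d → ℤ := reducedIndicator (p i).1.1 - reducedIndicator (p i).1.2
  set B := (reducedIncidence d).submatrix p id
  have mem (u v : Fin (d + 1)) :
      reducedIndicator u - reducedIndicator v ∈ Submodule.span ℤ (Set.range row) := by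
    obtain ⟨w⟩ := h.preconnected u v
    induction w with
    | nil => simp
    | @cons u v x huv _ ih =>
      rw [← sub_add_sub_cancel _ (reducedIndicator v)]
      refine add_mem ?_ ih
      rcases (SimpleGraph.fromRel_adj _ _ _).1 huv with ⟨-, ⟨i, hi⟩ | ⟨i, hi⟩⟩
      · exact Submodule.subset_span ⟨i, by simp only [row, hi]⟩
      · rw [← neg_sub]
        exact neg_mem (Submodule.subset_span ⟨i, by simp only [row, hi]⟩)
  have hsingle (k : Fin d) : ∃ c : Fin d → ℤ, ∑ i, c i • row i = Pi.single k 1 := by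
    rw [← Submodule.mem_span_range_iff_exists_fun]
    convert mem k.succ 0 using 1
    ext j
    simp [reducedIndicator, Pi.single_apply, eq_comm, Fin.succ_ne_zero]
  choose N hN using hsingle
  have hNB : Matrix.of N * B = 1 := by
    ext k j
    have := congrFun (hN k) j
    simp only [Finset.sum_apply, Pi.smul_apply, smul_eq_mul] at this
    rw [Matrix.mul_apply]
    refine Eq.trans this ?_
    simp [Matrix.one_apply, Pi.single_apply, eq_comm]
  have hu : IsUnit B.det := IsUnit.of_mul_eq_one_right (Matrix.of N).det (by
    rw [← Matrix.det_mul, hNB, Matrix.det_one])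
  exact Int.isUnit_sq hu

/-- The indicator of a component that avoids the root is in the kernel of the incidence matrix. -/
theorem det_reducedIncidence_of_not_connected {d : ℕ} (p : Fin d → OrderedPair (d + 1))
    (h : ¬ (graphOfPairs p).Connected) : ((reducedIncidence d).submatrix p id).det = 0 := by
  classical
  obtain ⟨v, hv⟩ : ∃ v, ¬ (graphOfPairs p).Reachable v 0 := by
    by_contra! hc
    exact h ⟨fun u v ↦ (hc u).trans (hc v).symm⟩
  let x : Fin (d + 1) → ℤ := fun u ↦ if (graphOfPairs p).Reachable v u then 1 else 0
  have hx0 : x 0 = 0 := if_neg hv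
  -- `x` vanishes at the root, so the coordinate left out by the reduced matrix does not matter.
  have hsum (u : Fin (d + 1)) : ∑ k, reducedIndicator u k * x k.succ = x u := by
    induction u using Fin.cases with
    | zero => simp [reducedIndicator, (Fin.succ_ne_zero _).symm, hx0]
    | succ u => simp [reducedIndicator]
  refine Matrix.exists_mulVec_eq_zero_iff.1 ⟨fun k ↦ x k.succ, ?_, ?_⟩
  · intro h0
    have hv0 : v ≠ 0 := by
      rintro rfl
      exact hv (SimpleGraph.Reachable.refl _)
    obtain ⟨k, rfl⟩ := Fin.exists_succ_eq.2 hv0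
    have := congrFun h0 k
    simp [x] at this
  · ext i
    have hadj : (graphOfPairs p).Adj (p i).1.1 (p i).1.2 :=
      (graphOfPairs_adj_iff p (p i)).2 ⟨i, rfl⟩
    have heq : x (p i).1.1 = x (p i).1.2 := by
      simp only [x]
      congr 1
      exact propext ⟨fun h ↦ h.trans hadj.reachable, fun h ↦ h.trans hadj.symm.reachable⟩
    simp only [Matrix.mulVec, dotProduct, reducedIncidence, Matrix.submatrix_apply, id,
      Matrix.of_apply, Pi.sub_apply, sub_mul, Finset.sum_sub_distrib, hsum, heq, sub_self,
      Pi.zero_apply]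

theorem card_filter_range_eq_factorial {α : Type*} [Fintype α] {d : ℕ} (S : Finset α) (hS : S.card = d)
    [DecidablePred fun p : Fin d → α ↦ Set.range p = S] :
    (Finset.univ.filter fun p : Fin d → α ↦ Set.range p = S).card = d.factorial := by
  classical
  have hinj (p : Fin d → α) (hp : Set.range p = S) : Function.Injective p := by
    have him : Finset.univ.image p = S := Finset.coe_injective (by simp [hp])
    rw [← Set.injOn_univ, ← Finset.coe_univ, ← Finset.card_image_iff, him, hS]
    simp
  have hmem (p : Fin d → α) (hp : Set.range p = S) (i : Fin d) : p i ∈ S := by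
    rw [← Finset.mem_coe, ← hp]
    exact ⟨i, rfl⟩
  let φ : {p : Fin d → α // Set.range p = S} ≃ (Fin d ≃ S) :=
    { toFun := fun p ↦ Equiv.ofBijective (fun i ↦ ⟨p.1 i, hmem p.1 p.2 i⟩)
        ⟨fun i j h ↦ hinj p.1 p.2 (congrArg Subtype.val h), fun s ↦ by
          obtain ⟨i, hi⟩ : s.1 ∈ Set.range p.1 := by rw [p.2]; exact s.2
          exact ⟨i, Subtype.ext hi⟩⟩
      invFun := fun e ↦ ⟨fun i ↦ e i, by
        ext x
        exact ⟨by rintro ⟨i, rfl⟩; exact (e i).2, fun hx ↦ ⟨e.symm ⟨x, hx⟩, by simp⟩⟩⟩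
      left_inv := fun p ↦ rfl
      right_inv := fun e ↦ by ext; rfl }
  rw [← Fintype.card_subtype, Fintype.card_congr φ,
    Fintype.card_equiv (Fintype.equivOfCardEq (by simp [hS])), Fintype.card_fin]

open Classical in
/-- The weighted matrix-tree theorem for the complete graph. -/
theorem det_reducedLaplacian {d : ℕ} (w : OrderedPair (d + 1) → ℝ) :
    (((reducedIncidence d).map (Int.castRingHom ℝ)).transpose * Matrix.diagonal w *
      (reducedIncidence d).map (Int.castRingHom ℝ)).det =
      ∑ T : SimpleGraph (Fin (d + 1)) with T.IsTree, ∏ e ∈ T.orderedPairs, w e := by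
  set B := (reducedIncidence d).map (Int.castRingHom ℝ)
  have hdet (p : Fin d → OrderedPair (d + 1)) : (B.submatrix p id).det =
      ((((reducedIncidence d).submatrix p id).det : ℤ) : ℝ) := by
    exact ((Int.castRingHom ℝ).map_det _).symm
  have hterm (p : Fin d → OrderedPair (d + 1)) :
      ((B.transpose * Matrix.diagonal w).submatrix id p).det * (B.submatrix p id).det =
        if (graphOfPairs p).Connected then ∏ i, w (p i) else 0 := by
    have : (B.transpose * Matrix.diagonal w).submatrix id p =
        (B.submatrix p id).transpose * Matrix.diagonal (w ∘ p) := by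
      ext i j
      simp [Matrix.mul_diagonal]
    rw [this, Matrix.det_mul, Matrix.det_transpose, Matrix.det_diagonal, hdet, mul_right_comm,
      ← sq, ← Int.cast_pow]
    split_ifs with hc
    · rw [det_reducedIncidence_sq_of_connected p hc]
      simp
    · rw [det_reducedIncidence_of_not_connected p hc]
      simp
  have hfiber (T : SimpleGraph (Fin (d + 1))) :
      (∑ p : Fin d → OrderedPair (d + 1) with graphOfPairs p = T,
        if (graphOfPairs p).Connected then ∏ i, w (p i) else 0) =
      if T.IsTree then (d.factorial : ℝ) * ∏ e ∈ T.orderedPairs, w e else 0 := by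
    by_cases hT : T.IsTree
    · have hcard : T.orderedPairs.card = d := by
        have := (SimpleGraph.isTree_iff_connected_and_card.1 hT).2
        rw [T.card_orderedPairs]
        simpa using this
      have hval (p : Fin d → OrderedPair (d + 1)) (hp : graphOfPairs p = T) :
          (if (graphOfPairs p).Connected then ∏ i, w (p i) else 0) =
            ∏ e ∈ T.orderedPairs, w e := by
        have him : Finset.univ.image p = T.orderedPairs := by
          apply Finset.coe_injective
          rw [← (graphOfPairs_eq_iff p T).1 hp]
          simp
        have hinj : Set.InjOn p (Finset.univ : Finset (Fin d)) := by
          rw [← Finset.card_image_iff, him, hcard]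
          simp
        rw [if_pos (hp ▸ hT.connected), ← him, Finset.prod_image hinj]
      rw [if_pos hT, Finset.sum_congr rfl fun p hp ↦ hval p (Finset.mem_filter.1 hp).2,
        Finset.sum_const, nsmul_eq_mul]
      congr 2
      simp only [graphOfPairs_eq_iff]
      exact card_filter_range_eq_factorial _ hcard
    · rw [if_neg hT]
      -- A connected graph on `d + 1` vertices whose edges are listed by `Fin d` is a tree.
      refine Finset.sum_eq_zero fun p hp ↦ if_neg fun hc ↦ hT ?_
      obtain ⟨-, rfl⟩ := Finset.mem_filter.1 hp
      refine SimpleGraph.isTree_iff_connected_and_card.2 ⟨hc, le_antisymm ?_ ?_⟩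
      · have him : Finset.univ.image p = (graphOfPairs p).orderedPairs := by
          apply Finset.coe_injective
          rw [← (graphOfPairs_eq_iff p _).1 rfl]
          simp
        rw [← SimpleGraph.card_orderedPairs, ← him]
        simpa using Finset.card_image_le (s := Finset.univ) (f := p)
      · exact hc.card_vert_le_card_edgeSet_add_one
  have hfac : (d.factorial : ℝ) ≠ 0 := by positivity
  apply mul_left_cancel₀ hfac
  have := Matrix.factorial_mul_det_mul (B.transpose * Matrix.diagonal w) B
  rw [Fintype.card_fin] at this
  rw [this, Finset.sum_congr rfl fun p _ ↦ hterm p,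
    ← Finset.sum_fiberwise (s := Finset.univ) (g := graphOfPairs),
    Finset.sum_congr rfl fun T _ ↦ hfiber T,
    Finset.mul_sum, Finset.sum_filter]

/-! ### The resultant as a Bezout determinant -/

/-- If the two lower blocks commute, a `2 × 2` block determinant is computed as for scalars. -/
theorem Matrix.det_fromBlocks_of_commute {m R : Type*} [Fintype m] [DecidableEq m] [CommRing R]
    (A B C D : Matrix m m R) (h : Commute C D) :
    (Matrix.fromBlocks A B C D).det = (A * D - B * C).det := by
  open Polynomial in
  -- The block `D` is replaced by `X + D` over `R[X]`, whose determinant is monic, hence regular.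
  let ι : R →+* R[X] := Polynomial.C
  let D' : Matrix m m R[X] := (-D).charmatrix
  have hD' : D' = Matrix.scalar m Polynomial.X + D.map ι := by
    ext i j : 2
    simp [D', Matrix.charmatrix, ι]
  have hcomm : Commute (C.map ι) D' := by
    rw [hD']
    refine Commute.add_right (Matrix.scalar_commute _ (fun _ ↦ Commute.all _ _) _).symm ?_
    have := congrArg (fun M ↦ M.map ι) h.eq
    rwa [Matrix.map_mul, Matrix.map_mul] at this
  have hprod : Matrix.fromBlocks (A.map ι) (B.map ι) (C.map ι) D' *
      Matrix.fromBlocks D' 0 (-(C.map ι)) 1 =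
      Matrix.fromBlocks (A.map ι * D' - B.map ι * C.map ι) (B.map ι) 0 D' := by
    rw [Matrix.fromBlocks_multiply]
    congr 1 <;> simp [sub_eq_add_neg, hcomm.eq]
  have hdet := congrArg Matrix.det hprod
  rw [Matrix.det_mul, Matrix.det_fromBlocks_zero₁₂, Matrix.det_fromBlocks_zero₂₁, Matrix.det_one,
    mul_one] at hdet
  have hreg : IsRegular D'.det := (Matrix.charpoly_monic (-D)).isRegular
  have hX := congrArg (Polynomial.evalRingHom 0) (hreg.right hdet)
  rw [RingHom.map_det, RingHom.map_det] at hX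
  have e0 (M : Matrix m m R) : (M.map ι).map (Polynomial.evalRingHom 0) = M := by
    ext; simp [ι]
  have eD : D'.map (Polynomial.evalRingHom 0) = D := by
    rw [hD']
    ext i j
    simp [ι, Matrix.scalar_apply, Matrix.diagonal_apply, apply_ite]
  rw [map_sub, map_mul, map_mul] at hX
  simpa only [RingHom.mapMatrix_apply, Matrix.fromBlocks_map, e0, eD] using hX

@[to_additive]
theorem Fintype.prod_orderedPair {n : ℕ} {M : Type*} [CommMonoid M] (f : Fin n → Fin n → M) :
    ∏ e : OrderedPair n, f e.1.1 e.1.2 = ∏ i, ∏ j ∈ Finset.Ioi i, f i j := by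
  rw [← Finset.prod_subtype (p := fun e : Fin n × Fin n ↦ e.1 < e.2)
    (Finset.univ.filter fun e : Fin n × Fin n ↦ e.1 < e.2) (by simp) (fun e ↦ f e.1 e.2),
    Finset.prod_filter, Fintype.prod_prod_type]
  refine Finset.prod_congr rfl fun i _ ↦ ?_
  rw [← Finset.prod_filter]
  congr 1
  ext
  simp

namespace Polynomial

variable {R : Type*} [CommRing R]

/-- The Bezout matrix of two polynomials of formal degree `d`: the coefficient of `x ^ i * y ^ j`
in `(f y * g x - f x * g y) / (y - x)`. -/
def bezoutMatrix (d : ℕ) (f g : R[X]) : Matrix (Fin d) (Fin d) R :=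
  .of fun i j ↦ ∑ k ∈ Finset.range (i + 1),
    (g.coeff (i - k) * f.coeff (j + 1 + k) - f.coeff (i - k) * g.coeff (j + 1 + k))

/-- The lower triangular Toeplitz matrix of the low coefficients of a polynomial. -/
def lowToeplitz (d : ℕ) (f : R[X]) : Matrix (Fin d) (Fin d) R :=
  .of fun i j ↦ if j ≤ i then f.coeff (i - j) else 0

/-- The upper triangular Toeplitz matrix of the high coefficients of a polynomial of formal
degree `d`. -/
def highToeplitz (d : ℕ) (f : R[X]) : Matrix (Fin d) (Fin d) R :=
  .of fun i j ↦ if i ≤ j then f.coeff (d + i - j) else 0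

theorem sylvester_eq_fromBlocks (d : ℕ) (f g : R[X]) :
    (sylvester f g d d).submatrix finSumFinEquiv finSumFinEquiv =
      Matrix.fromBlocks (lowToeplitz d g) (lowToeplitz d f) (highToeplitz d g)
        (highToeplitz d f) := by
  ext i j
  rcases i with i | i <;> rcases j with j | j <;>
    simp only [Matrix.submatrix_apply, sylvester, lowToeplitz, highToeplitz, Matrix.of_apply,
      finSumFinEquiv_apply_left, finSumFinEquiv_apply_right, Fin.addCases_left,
      Fin.addCases_right, Matrix.fromBlocks_apply₁₁, Matrix.fromBlocks_apply₁₂,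
      Matrix.fromBlocks_apply₂₁, Matrix.fromBlocks_apply₂₂, Set.mem_Icc, Fin.val_castAdd,
      Fin.val_natAdd, Fin.le_def] <;>
    exact if_congr (by omega) rfl rfl

theorem commute_highToeplitz (d : ℕ) (f g : R[X]) :
    Commute (highToeplitz d g) (highToeplitz d f) := by
  ext i j
  simp only [Matrix.mul_apply, highToeplitz, Matrix.of_apply]
  -- The substitution `k ↦ i + j - k` exchanges the two convolutions.
  by_cases hij : i ≤ j
  · have h (p q : R[X]) : (∑ k : Fin d, (if i ≤ k then p.coeff (d + i - k) else 0) *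
        (if k ≤ j then q.coeff (d + k - j) else 0)) =
        ∑ k ∈ Finset.Icc i j, p.coeff (d + i - k) * q.coeff (d + k - j) := by
      rw [← Finset.sum_subset (Finset.subset_univ (Finset.Icc i j))]
      · refine Finset.sum_congr rfl fun k hk ↦ ?_
        rw [Finset.mem_Icc] at hk
        rw [if_pos hk.1, if_pos hk.2]
      · intro k _ hk
        rw [Finset.mem_Icc, not_and_or] at hk
        rcases hk with hk | hk <;> simp [hk]
    rw [h, h]
    have hmem (k : Fin d) : k ∈ Finset.Icc i j ↔ (i : ℕ) ≤ k ∧ (k : ℕ) ≤ j := by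
      rw [Finset.mem_Icc, Fin.le_def, Fin.le_def]
    have hlt (k : Fin d) (hk : k ∈ Finset.Icc i j) : (i + j - k : ℕ) < d := by
      rw [hmem] at hk
      omega
    refine Finset.sum_bij' (fun k hk ↦ ⟨i + j - k, hlt k hk⟩) (fun k hk ↦ ⟨i + j - k, hlt k hk⟩)
      ?_ ?_ ?_ ?_ ?_
    all_goals
      intro k hk
      rw [hmem] at hk
    · rw [hmem]
      simp only
      omega
    · rw [hmem]
      simp only
      omega
    · ext
      simp only
      omega
    · ext
      simp only
      omega
    · rw [mul_comm]
      congr 2 <;> simp only <;> omega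
  · rw [Finset.sum_eq_zero, Finset.sum_eq_zero]
    all_goals
      intro k _
      by_cases h1 : i ≤ k <;> by_cases h2 : k ≤ j <;> simp [h1, h2]
      exact absurd (h1.trans h2) hij

/-- The columns of the Bezout matrix appear in reverse order. The degree bounds make the terms
with `k > j` in the sums defining `bezoutMatrix` vanish. -/
theorem lowToeplitz_mul_highToeplitz (d : ℕ) (f g : R[X]) (hf : f.natDegree ≤ d)
    (hg : g.natDegree ≤ d) :
    lowToeplitz d g * highToeplitz d f - lowToeplitz d f * highToeplitz d g =
      (bezoutMatrix d f g).submatrix id Fin.revPerm := by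
  have key (p q : R[X]) (hq : q.natDegree ≤ d) (i j : Fin d) :
      (lowToeplitz d p * highToeplitz d q) i j =
        ∑ k ∈ Finset.range (i + 1), p.coeff (i - k) * q.coeff (j.rev + 1 + k) := by
    simp only [Matrix.mul_apply, lowToeplitz, highToeplitz, Matrix.of_apply, Fin.le_def]
    rw [Fin.sum_univ_eq_sum_range (fun k ↦ (if k ≤ (i : ℕ) then p.coeff (i - k) else 0) *
      (if k ≤ (j : ℕ) then q.coeff (d + k - j) else 0)) d]
    symm
    rw [Finset.sum_congr rfl (g := fun k ↦ (if k ≤ (i : ℕ) then p.coeff (i - k) else 0) *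
      (if k ≤ (j : ℕ) then q.coeff (d + k - j) else 0))]
    · refine Finset.sum_subset (Finset.range_subset_range.2 i.2) fun k _ hk ↦ ?_
      rw [Finset.mem_range] at hk
      rw [if_neg (by omega), zero_mul]
    · intro k hk
      rw [Finset.mem_range] at hk
      rw [if_pos (by omega), Fin.val_rev]
      split_ifs with hkj
      · congr 2
        omega
      · rw [coeff_eq_zero_of_natDegree_lt (p := q) (by omega), mul_zero]
  ext i j
  rw [Matrix.sub_apply, key _ _ hf, key _ _ hg, ← Finset.sum_sub_distrib]
  rfl

theorem _root_.Fin.sign_revPerm (d : ℕ) :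
    ((Equiv.Perm.sign (Fin.revPerm : Equiv.Perm (Fin d)) : ℤˣ) : ℤ) = (-1) ^ d.choose 2 := by
  rw [Equiv.Perm.sign_eq_prod_prod_Ioi]
  have h (i : Fin d) : (∏ j ∈ Finset.Ioi i,
      if Fin.revPerm i < Fin.revPerm j then (1 : ℤˣ) else -1) = (-1) ^ (Fin.revPerm i : ℕ) := by
    rw [Finset.prod_congr rfl (g := fun _ ↦ (-1 : ℤˣ)), Finset.prod_const, Fin.card_Ioi]
    · simp [Fin.val_rev, Nat.sub_sub, add_comm]
    · intro j hj
      rw [if_neg]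
      simpa using (Finset.mem_Ioi.1 hj).le
  rw [Finset.prod_congr rfl fun i _ ↦ h i,
    Equiv.prod_comp Fin.revPerm (fun i ↦ (-1 : ℤˣ) ^ (i : ℕ)),
    Finset.prod_pow_eq_pow_sum, Fin.sum_univ_eq_sum_range (fun i ↦ i), Finset.sum_range_id,
    Nat.choose_two_right]
  simp

theorem resultant_eq_det_bezoutMatrix (d : ℕ) (f g : R[X]) (hf : f.natDegree ≤ d)
    (hg : g.natDegree ≤ d) :
    resultant f g d d = (-1) ^ d.choose 2 * (bezoutMatrix d f g).det := by
  rw [resultant, ← Matrix.det_submatrix_equiv_self finSumFinEquiv, sylvester_eq_fromBlocks,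
    Matrix.det_fromBlocks_of_commute _ _ _ _ (commute_highToeplitz d f g),
    lowToeplitz_mul_highToeplitz d f g hf hg, Matrix.det_permute', Fin.sign_revPerm]
  simp

/-- The Bezout matrix is bilinear and alternating, so the coefficients enter through their
`2 × 2` minors. -/
theorem bezoutMatrix_sum_sum {n : ℕ} (d : ℕ) (b c : Fin n → R)
    (Q : Fin n → R[X]) :
    bezoutMatrix d (∑ i, C (b i) * Q i) (∑ i, C (c i) * Q i) =
      ∑ e : OrderedPair n, (b e.1.1 * c e.1.2 - b e.1.2 * c e.1.1) •
        bezoutMatrix d (Q e.1.1) (Q e.1.2) := by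
  have hswap (i j : Fin n) : bezoutMatrix d (Q i) (Q j) = -bezoutMatrix d (Q j) (Q i) := by
    ext s t
    simp only [bezoutMatrix, Matrix.of_apply, Matrix.neg_apply, ← Finset.sum_neg_distrib]
    exact Finset.sum_congr rfl fun k _ ↦ by ring
  have hself (i : Fin n) : bezoutMatrix d (Q i) (Q i) = 0 := by
    ext s t
    simp [bezoutMatrix]
  have hbilin : bezoutMatrix d (∑ i, C (b i) * Q i) (∑ i, C (c i) * Q i) =
      ∑ i, ∑ j, (b i * c j) • bezoutMatrix d (Q i) (Q j) := by
    ext s t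
    simp only [bezoutMatrix, Matrix.of_apply, Matrix.sum_apply, Matrix.smul_apply, finsetSum_coeff,
      coeff_C_mul, Finset.smul_sum]
    rw [Finset.sum_congr rfl fun i _ ↦ Finset.sum_comm, Finset.sum_comm]
    refine Finset.sum_congr rfl fun k _ ↦ ?_
    simp only [smul_eq_mul]
    rw [mul_comm, Finset.sum_mul_sum, Finset.sum_mul_sum, ← Finset.sum_sub_distrib]
    refine Finset.sum_congr rfl fun i _ ↦ ?_
    rw [← Finset.sum_sub_distrib]
    exact Finset.sum_congr rfl fun j _ ↦ by ring
  rw [hbilin, Fintype.sum_orderedPair fun i j ↦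
    (b i * c j - b j * c i) • bezoutMatrix d (Q i) (Q j), Finset.sum_comm]
  have h := Finset.sum_sum_Ioi_add_eq_sum_sum_off_diag
    fun i j ↦ (b i * c j) • bezoutMatrix d (Q i) (Q j)
  rw [Finset.sum_congr rfl fun j _ ↦ (Finset.sum_subset (Finset.subset_univ {j}ᶜ) ?_).symm, ← h]
  · refine Finset.sum_congr rfl fun i _ ↦ Finset.sum_congr rfl fun j _ ↦ ?_
    rw [hswap j i, sub_smul, smul_neg, add_comm, sub_eq_add_neg]
  · intro i _ hi
    obtain rfl : i = j := by simpa using hi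
    rw [hself, smul_zero]

/-- The Bezout matrix of two multiples of `q` by linear polynomials has rank one; its
defining sum telescopes. -/
theorem bezoutMatrix_linear_mul (d : ℕ) (a b a' b' : R) (q : R[X]) (i j : Fin d) :
    bezoutMatrix d ((C a' * X + C b') * q) ((C a * X + C b) * q) i j =
      -((a * b' - a' * b) * (q.coeff i * q.coeff j)) := by
  have h0 (a b : R) : ((C a * X + C b) * q).coeff 0 = b * q.coeff 0 := by
    simp [mul_coeff_zero]
  have hs (a b : R) (n : ℕ) : ((C a * X + C b) * q).coeff (n + 1) =
      a * q.coeff n + b * q.coeff (n + 1) := by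
    rw [add_mul, mul_assoc, coeff_add, coeff_C_mul, coeff_C_mul, coeff_X_mul]
  -- In terms of the coefficients of `q`, each summand is a difference of consecutive terms.
  have h (m t : ℕ) : ∑ k ∈ Finset.range t, (((C a * X + C b) * q).coeff (m + t - k) *
      ((C a' * X + C b') * q).coeff (j + 1 + k) - ((C a' * X + C b') * q).coeff (m + t - k) *
      ((C a * X + C b) * q).coeff (j + 1 + k)) = (a' * b - a * b') *
        (q.coeff (m + t) * q.coeff j - q.coeff m * q.coeff (j + t)) := by
    rw [Finset.sum_congr rfl (g := fun k ↦ (a' * b - a * b') *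
      (q.coeff (m + t - k) * q.coeff (j + k) - q.coeff (m + t - (k + 1)) * q.coeff (j + (k + 1)))),
      ← Finset.mul_sum, Finset.sum_range_sub']
    · simp
    · intro k hk
      rw [Finset.mem_range] at hk
      obtain ⟨r, hr⟩ : ∃ r, m + t - k = r + 1 := ⟨m + t - k - 1, by omega⟩
      rw [show m + t - (k + 1) = r by omega, hr, add_right_comm, hs, hs, hs, hs]
      ring_nf
  have h' := h 0 i
  simp only [bezoutMatrix, Matrix.of_apply, Finset.sum_range_succ]
  rw [zero_add] at h'
  rw [h', Nat.sub_self, h0, h0, add_right_comm, hs, hs]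
  ring

end Polynomial

/-! ### Binary forms and their dehomogenization -/

theorem minor_eq {n : ℕ} (M : Matrix (Fin 2) (Fin n) ℝ) (i j : Fin n) :
    minor M i j = M 0 i * M 1 j - M 0 j * M 1 i := by
  simp [minor, Matrix.det_fin_two]

theorem isHomogeneous_linForm {n : ℕ} (a : Matrix (Fin 2) (Fin n) ℝ) (j : Fin n) :
    (linForm a j).IsHomogeneous 1 :=
  (isHomogeneous_C_mul_X _ _).add (isHomogeneous_C_mul_X _ _)

theorem isHomogeneous_prod_erase_linForm {n : ℕ} (a : Matrix (Fin 2) (Fin n) ℝ) (i : Fin n) :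
    (∏ j ∈ Finset.univ.erase i, linForm a j).IsHomogeneous (n - 1) := by
  simpa [Finset.card_erase_of_mem] using
    IsHomogeneous.prod (Finset.univ.erase i) _ _ fun j _ ↦ isHomogeneous_linForm a j

theorem isHomogeneous_interpForm {n : ℕ} (a : Matrix (Fin 2) (Fin n) ℝ) (c : Fin n → ℝ) :
    (interpForm a c).IsHomogeneous (n - 1) :=
  IsHomogeneous.sum _ _ _ fun i _ ↦ (isHomogeneous_prod_erase_linForm a i).C_mul _

/-- The dehomogenization of `linForm a j`. -/
noncomputable def affineLinForm {n : ℕ} (a : Matrix (Fin 2) (Fin n) ℝ) (j : Fin n) : Polynomial ℝ :=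
  Polynomial.C (a 0 j) * Polynomial.X + Polynomial.C (a 1 j)

theorem dehomog_linForm {n : ℕ} (a : Matrix (Fin 2) (Fin n) ℝ) (j : Fin n) :
    dehomog (linForm a j) = affineLinForm a j := by
  simp [dehomog, linForm, affineLinForm]

theorem dehomog_prod_linForm {n : ℕ} (a : Matrix (Fin 2) (Fin n) ℝ) (s : Finset (Fin n)) :
    dehomog (∏ j ∈ s, linForm a j) = ∏ j ∈ s, affineLinForm a j := by
  rw [← Finset.prod_congr rfl fun j _ ↦ dehomog_linForm a j]
  exact map_prod (aeval ![Polynomial.X, 1]) _ _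

theorem dehomog_interpForm {n : ℕ} (a : Matrix (Fin 2) (Fin n) ℝ) (c : Fin n → ℝ) :
    dehomog (interpForm a c) =
      ∑ i, Polynomial.C (c i) * ∏ j ∈ Finset.univ.erase i, affineLinForm a j := by
  rw [dehomog, interpForm, map_sum]
  refine Finset.sum_congr rfl fun i _ ↦ ?_
  rw [map_mul, ← dehomog_prod_linForm, dehomog]
  simp

theorem natDegree_prod_affineLinForm_le {n : ℕ} (a : Matrix (Fin 2) (Fin n) ℝ)
    (s : Finset (Fin n)) : (∏ j ∈ s, affineLinForm a j).natDegree ≤ s.card := by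
  refine (Polynomial.natDegree_prod_le s (affineLinForm a)).trans ?_
  have h (j : Fin n) : (affineLinForm a j).natDegree ≤ 1 := Polynomial.natDegree_linear_le
  simpa using Finset.sum_le_card_nsmul s (fun j ↦ (affineLinForm a j).natDegree) 1 fun j _ ↦ h j

/-- A binary form of degree `N` is recovered from its dehomogenization. -/
theorem MvPolynomial.IsHomogeneous.eq_sum_coeff_dehomog {F : MvPolynomial (Fin 2) ℝ} {N : ℕ}
    (hF : F.IsHomogeneous N) :
    F = ∑ k ∈ Finset.range (N + 1), C ((dehomog F).coeff k) * (X 0 ^ k * X 1 ^ (N - k)) := by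
  let T : MvPolynomial (Fin 2) ℝ →+ MvPolynomial (Fin 2) ℝ :=
    { toFun := fun G ↦
        ∑ k ∈ Finset.range (N + 1), C ((dehomog G).coeff k) * (X 0 ^ k * X 1 ^ (N - k))
      map_zero' := by simp [dehomog]
      map_add' := fun G G' ↦ by simp [dehomog, add_mul, Finset.sum_add_distrib] }
  change F = T F
  conv_rhs => rw [F.as_sum]
  rw [map_sum]
  conv_lhs => rw [F.as_sum]
  refine Finset.sum_congr rfl fun s hs ↦ ?_
  have hsum : s 0 + s 1 = N := by
    have := hF (mem_support_iff.1 hs)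
    rw [← this, Finsupp.weight_apply, Finsupp.sum_fintype _ _ (by simp), Fin.sum_univ_two]
    simp
  have hmon : dehomog (monomial s (coeff s F)) = Polynomial.monomial (s 0) (coeff s F) := by
    rw [dehomog, aeval_monomial, Finsupp.prod_fintype _ _ (by simp), Fin.prod_univ_two]
    simp [Polynomial.C_mul_X_pow_eq_monomial]
  change _ = ∑ k ∈ Finset.range (N + 1), _
  rw [hmon, Finset.sum_eq_single (s 0)]
  · rw [Polynomial.coeff_monomial, if_pos rfl, monomial_eq, Finsupp.prod_fintype _ _ (by simp),
      Fin.prod_univ_two, ← hsum, Nat.add_sub_cancel_left]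
  · intro k _ hk
    rw [Polynomial.coeff_monomial, if_neg hk.symm, C_0, zero_mul]
  · intro h
    rw [Finset.mem_range] at h
    omega

theorem MvPolynomial.IsHomogeneous.eval_eq_sum_coeff_dehomog {F : MvPolynomial (Fin 2) ℝ} {N : ℕ}
    (hF : F.IsHomogeneous N) (v w : ℝ) :
    eval ![v, w] F =
      ∑ k ∈ Finset.range (N + 1), (dehomog F).coeff k * (v ^ k * w ^ (N - k)) := by
  conv_lhs => rw [IsHomogeneous.eq_sum_coeff_dehomog hF]
  simp [map_sum]

theorem MvPolynomial.IsHomogeneous.ext_coeff_dehomog {F G : MvPolynomial (Fin 2) ℝ} {N : ℕ}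
    (hF : F.IsHomogeneous N) (hG : G.IsHomogeneous N)
    (h : ∀ k < N + 1, (dehomog F).coeff k = (dehomog G).coeff k) : F = G := by
  rw [IsHomogeneous.eq_sum_coeff_dehomog hF, IsHomogeneous.eq_sum_coeff_dehomog hG]
  exact Finset.sum_congr rfl fun k hk ↦ by rw [h k (Finset.mem_range.1 hk)]

/-- A linear form with only one root is non-zero, and forms with distinct roots are not
proportional. -/
theorem minor_ne_zero {n : ℕ} {a : Matrix (Fin 2) (Fin n) ℝ}
    {r : Fin n → ℙ ℝ (Fin 2 → ℝ)} (hr : Function.Injective r)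
    (hroot : ∀ j p, IsProjRoot (linForm a j) p ↔ p = r j) {i j : Fin n} (hij : i ≠ j) :
    minor a i j ≠ 0 := by
  have heval (k : Fin n) (v : Fin 2 → ℝ) : eval v (linForm a k) = a 0 k * v 0 + a 1 k * v 1 := by
    simp [linForm]
  -- The root of `ℓ_j` is `[-a_{2j} : a_{1j}]`, which lies on `ℓ_i` when the minor vanishes.
  intro h0
  rw [minor_eq] at h0
  apply hij
  have hv : ![-a 1 j, a 0 j] ≠ 0 := by
    intro hv
    have h1 : a 1 j = 0 := by simpa using congrFun hv 0
    have h2 : a 0 j = 0 := by simpa using congrFun hv 1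
    have hall (p : ℙ ℝ (Fin 2 → ℝ)) : p = r j := by
      rw [← hroot, IsProjRoot, heval, h1, h2]
      simp
    exact hij (hr (hall _))
  have hmk (k : Fin n) (hk : a 0 k * -a 1 j + a 1 k * a 0 j = 0) :
      Projectivization.mk ℝ ![-a 1 j, a 0 j] hv = r k := by
    rw [← hroot, IsProjRoot, heval]
    obtain ⟨t, ht⟩ := Projectivization.exists_smul_eq_mk_rep ℝ ![-a 1 j, a 0 j] hv
    rw [← ht]
    simp only [Units.smul_def, Pi.smul_apply, smul_eq_mul, Matrix.cons_val_zero,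
      Matrix.cons_val_one]
    linear_combination (t : ℝ) * hk
  exact hr ((hmk i (by linear_combination -h0)).symm.trans (hmk j (by ring)))

/-! ### The interpolation basis -/

/-- The coefficients of the forms `∏_{j ≠ i} ℓ_j`; the row index is `i`. -/
noncomputable def interpMatrix {n : ℕ} (a : Matrix (Fin 2) (Fin n) ℝ) : Matrix (Fin n) (Fin n) ℝ :=
  .of fun i k ↦ (∏ j ∈ Finset.univ.erase i, affineLinForm a j).coeff k

/-- The form `∏_{j ≠ i} ℓ_j` vanishes at the roots of all `ℓ_j` but `ℓ_i`. -/
theorem interpMatrix_mul_projVandermonde {n : ℕ} (a : Matrix (Fin 2) (Fin n) ℝ) :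
    interpMatrix a * (Matrix.projVandermonde (fun j ↦ -a 1 j) (a 0)).transpose =
      Matrix.diagonal fun i ↦ ∏ j ∈ Finset.univ.erase i, minor a i j := by
  ext i j
  obtain ⟨d, rfl⟩ : ∃ d, n = d + 1 := ⟨n - 1, by have := i.2; omega⟩
  have heval := IsHomogeneous.eval_eq_sum_coeff_dehomog
    (isHomogeneous_prod_erase_linForm a i) (-a 1 j) (a 0 j)
  rw [dehomog_prod_linForm, Nat.add_sub_cancel] at heval
  have hmul : (interpMatrix a *
      (Matrix.projVandermonde (fun j ↦ -a 1 j) (a 0)).transpose) i j =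
      ∏ m ∈ Finset.univ.erase i, minor a j m := by
    rw [Matrix.mul_apply]
    trans eval ![-a 1 j, a 0 j] (∏ m ∈ Finset.univ.erase i, linForm a m)
    · rw [heval, ← Fin.sum_univ_eq_sum_range (fun k ↦
        (∏ j ∈ Finset.univ.erase i, affineLinForm a j).coeff k *
          ((-a 1 j) ^ k * a 0 j ^ (d - k)))]
      refine Finset.sum_congr rfl fun k _ ↦ ?_
      rw [Matrix.transpose_apply, Matrix.projVandermonde_apply, Fin.val_rev, interpMatrix,
        Matrix.of_apply, Nat.add_sub_add_right]
    · rw [map_prod]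
      refine Finset.prod_congr rfl fun m _ ↦ ?_
      rw [minor_eq]
      simp [linForm]
      ring
  rw [hmul, Matrix.diagonal_apply]
  split_ifs with hij
  · rw [hij]
  · refine Finset.prod_eq_zero (Finset.mem_erase.2 ⟨Ne.symm hij, Finset.mem_univ j⟩) ?_
    rw [minor_eq, sub_self]

/-- Only the square is needed, so the signs of the minors in the Vandermonde determinant and in
the values at the roots can be ignored. -/
theorem det_interpMatrix_sq {n : ℕ} (a : Matrix (Fin 2) (Fin n) ℝ)
    (h : ∀ i j, i ≠ j → minor a i j ≠ 0) :
    (interpMatrix a).det ^ 2 = (∏ e : OrderedPair n, minor a e.1.1 e.1.2) ^ 2 := by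
  set P := ∏ e : OrderedPair n, minor a e.1.1 e.1.2 with hP
  have hP0 : P ≠ 0 := Finset.prod_ne_zero_iff.2 fun e _ ↦ h _ _ e.2.ne
  have hV : (Matrix.projVandermonde (fun j ↦ -a 1 j) (a 0)).det ^ 2 = P ^ 2 := by
    rw [Matrix.det_projVandermonde, hP, Fintype.prod_orderedPair, ← Finset.prod_pow,
      ← Finset.prod_pow]
    refine Finset.prod_congr rfl fun i _ ↦ ?_
    rw [← Finset.prod_pow, ← Finset.prod_pow]
    refine Finset.prod_congr rfl fun j _ ↦ ?_
    rw [minor_eq]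
    ring
  have hD : (∏ i, ∏ j ∈ Finset.univ.erase i, minor a i j) ^ 2 = (P ^ 2) ^ 2 := by
    have := Finset.prod_prod_Ioi_mul_eq_prod_prod_off_diag fun i j ↦ minor a j i
    simp only [Finset.compl_eq_univ_sdiff, Finset.sdiff_singleton_eq_erase] at this
    rw [← this, hP, Fintype.prod_orderedPair]
    simp only [← Finset.prod_pow]
    refine Finset.prod_congr rfl fun i _ ↦ Finset.prod_congr rfl fun j _ ↦ ?_
    rw [minor_eq, minor_eq]
    ring
  have hdet := congrArg (fun M ↦ M.det ^ 2) (interpMatrix_mul_projVandermonde a)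
  simp only [Matrix.det_mul, Matrix.det_transpose, Matrix.det_diagonal, mul_pow, hV, hD] at hdet
  refine mul_right_cancel₀ (pow_ne_zero 2 hP0) (hdet.trans (by ring))

theorem existsUnique_eq_interpForm {n : ℕ} (hn : 1 ≤ n) (a : Matrix (Fin 2) (Fin n) ℝ)
    (h : ∀ i j, i ≠ j → minor a i j ≠ 0) {F : MvPolynomial (Fin 2) ℝ}
    (hF : F.IsHomogeneous (n - 1)) : ∃! c : Fin n → ℝ, F = interpForm a c := by
  have hdet : IsUnit (interpMatrix a).det := by
    have h2 := det_interpMatrix_sq a h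
    refine isUnit_iff_ne_zero.2 fun h0 ↦ ?_
    rw [h0, zero_pow two_ne_zero] at h2
    exact pow_ne_zero 2 (Finset.prod_ne_zero_iff.2 fun e _ ↦ h _ _ e.2.ne) h2.symm
  have hiff (c : Fin n → ℝ) : F = interpForm a c ↔
      Matrix.vecMul c (interpMatrix a) = fun k : Fin n ↦ (dehomog F).coeff k := by
    have hcoeff (k : Fin n) : (dehomog (interpForm a c)).coeff k =
        Matrix.vecMul c (interpMatrix a) k := by
      simp [dehomog_interpForm, Matrix.vecMul, dotProduct, interpMatrix]
    constructor
    · rintro rfl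
      ext k
      rw [hcoeff]
    · intro hc
      refine IsHomogeneous.ext_coeff_dehomog hF (isHomogeneous_interpForm a c) fun k hk ↦ ?_
      rw [hcoeff ⟨k, by omega⟩, hc]
  simp only [hiff]
  have hinv := (Matrix.isUnit_iff_isUnit_det _).2 hdet
  have hbij : Function.Bijective fun c ↦ Matrix.vecMul c (interpMatrix a) :=
    ⟨Matrix.vecMul_injective_of_isUnit hinv, Matrix.vecMul_surjective_iff_isUnit.2 hinv⟩
  exact hbij.existsUnique _

/-! ### The Bezout matrix as a weighted Laplacian -/

/-- The dehomogenization of `p_{v0}(a) ∏_{m ≠ v, 0} ℓ_m`. It is attached to the vertex `v` of the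
complete graph and vanishes at the root vertex `0`. -/
noncomputable def potential {d : ℕ} (a : Matrix (Fin 2) (Fin (d + 1)) ℝ) (v : Fin (d + 1)) :
    Polynomial ℝ :=
  Polynomial.C (minor a v 0) * ∏ m ∈ (Finset.univ.erase v).erase 0, affineLinForm a m

theorem potential_zero {d : ℕ} (a : Matrix (Fin 2) (Fin (d + 1)) ℝ) : potential a 0 = 0 := by
  simp [potential, minor_eq]

/-- Up to a common factor, this is the Plücker relation
`p_{ij} ℓ_0 = p_{i0} ℓ_j - p_{j0} ℓ_i`. -/
theorem C_minor_mul_prod_eq_potential_sub {d : ℕ} (a : Matrix (Fin 2) (Fin (d + 1)) ℝ)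
    (i j : Fin (d + 1)) (hij : i ≠ j) :
    Polynomial.C (minor a i j) * ∏ m ∈ (Finset.univ.erase i).erase j, affineLinForm a m =
      potential a i - potential a j := by
  rcases eq_or_ne i 0 with rfl | hi
  · rw [potential_zero, potential, Finset.erase_right_comm, minor_eq, minor_eq, zero_sub,
      ← neg_mul, ← map_neg]
    ring_nf
  rcases eq_or_ne j 0 with rfl | hj
  · rw [potential_zero, potential, sub_zero]
  let R := ∏ m ∈ ((Finset.univ.erase i).erase j).erase 0, affineLinForm a m
  have h0 : ∏ m ∈ (Finset.univ.erase i).erase j, affineLinForm a m = affineLinForm a 0 * R :=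
    (Finset.mul_prod_erase _ (affineLinForm a) (a := 0) (by simp [hi.symm, hj.symm])).symm
  have h1 : ∏ m ∈ (Finset.univ.erase i).erase 0, affineLinForm a m = affineLinForm a j * R := by
    simp only [R]
    rw [Finset.erase_right_comm (a := j) (b := 0)]
    exact (Finset.mul_prod_erase _ (affineLinForm a) (a := j) (by simp [hij.symm, hj])).symm
  have h2 : ∏ m ∈ (Finset.univ.erase j).erase 0, affineLinForm a m = affineLinForm a i * R := by
    simp only [R]
    rw [Finset.erase_right_comm (a := i) (b := j), Finset.erase_right_comm (a := i) (b := 0)]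
    exact (Finset.mul_prod_erase _ (affineLinForm a) (a := i) (by simp [hij, hi])).symm
  rw [potential, potential, h0, h1, h2]
  clear_value R
  simp only [minor_eq, affineLinForm, map_sub, map_mul]
  ring

/-- The coefficients of the potentials of the vertices other than the root `0`. -/
noncomputable def potentialMatrix {d : ℕ} (a : Matrix (Fin 2) (Fin (d + 1)) ℝ) :
    Matrix (Fin d) (Fin d) ℝ :=
  .of fun v k ↦ (potential a v.succ).coeff k

theorem det_potentialMatrix_sq {d : ℕ} (a : Matrix (Fin 2) (Fin (d + 1)) ℝ)
    (h : ∀ i j, i ≠ j → minor a i j ≠ 0) :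
    (potentialMatrix a).det ^ 2 = (∏ e : OrderedPair (d + 1), minor a e.1.1 e.1.2) ^ 2 := by
  have hM : potentialMatrix a = Matrix.diagonal (fun v : Fin d ↦ minor a v.succ 0) *
      interpMatrix (a.submatrix id Fin.succ) := by
    ext v k
    have himage : (Finset.univ.erase v.succ).erase 0 =
        (Finset.univ.erase v).map (Fin.succEmb d) := by
      ext m
      induction m using Fin.cases <;> simp [Fin.succ_ne_zero]
    rw [Matrix.diagonal_mul, potentialMatrix, Matrix.of_apply, potential, himage,
      Finset.prod_map, Polynomial.coeff_C_mul]
    rfl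
  have hm (i j : Fin d) : minor (a.submatrix id Fin.succ) i j = minor a i.succ j.succ := by
    rw [minor_eq, minor_eq]
    rfl
  rw [hM, Matrix.det_mul, Matrix.det_diagonal, mul_pow, det_interpMatrix_sq _ fun i j hij ↦ by
    rw [hm]
    exact h _ _ fun h' ↦ hij (Fin.succ_injective _ h'), Fintype.prod_orderedPair,
    Fintype.prod_orderedPair, Fin.prod_univ_succ, Fin.prod_Ioi_zero, mul_pow]
  simp only [Fin.prod_Ioi_succ, hm, ← Finset.prod_pow]
  congr 1
  refine Finset.prod_congr rfl fun i _ ↦ ?_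
  rw [minor_eq, minor_eq]
  ring

/-- The difference of the potentials at the ends of an edge. -/
theorem reducedIncidence_mul_potentialMatrix {d : ℕ} (a : Matrix (Fin 2) (Fin (d + 1)) ℝ)
    (e : OrderedPair (d + 1)) (k : Fin d) :
    ((reducedIncidence d).map (Int.castRingHom ℝ) * potentialMatrix a) e k =
      minor a e.1.1 e.1.2 *
        (∏ m ∈ (Finset.univ.erase e.1.1).erase e.1.2, affineLinForm a m).coeff k := by
  have hsum (v : Fin (d + 1)) :
      ∑ l, (reducedIndicator v l : ℝ) * potentialMatrix a l k = (potential a v).coeff k := by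
    induction v using Fin.cases with
    | zero => simp [reducedIndicator, potential_zero, (Fin.succ_ne_zero _).symm]
    | succ v => simp [reducedIndicator, potentialMatrix]
  rw [← Polynomial.coeff_C_mul, C_minor_mul_prod_eq_potential_sub a _ _ e.2.ne,
    Polynomial.coeff_sub, ← hsum, ← hsum, ← Finset.sum_sub_distrib, Matrix.mul_apply]
  refine Finset.sum_congr rfl fun l _ ↦ ?_
  simp [reducedIncidence, sub_mul]

theorem bezoutMatrix_dehomog_interpForm {d : ℕ} (a c : Matrix (Fin 2) (Fin (d + 1)) ℝ)
    (h : ∀ i j, i ≠ j → minor a i j ≠ 0) :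
    Polynomial.bezoutMatrix d (dehomog (interpForm a (c 0))) (dehomog (interpForm a (c 1))) =
      -((potentialMatrix a).transpose * (((reducedIncidence d).map (Int.castRingHom ℝ)).transpose *
        Matrix.diagonal (fun e : OrderedPair (d + 1) ↦
          minor c e.1.1 e.1.2 / minor a e.1.1 e.1.2) *
        (reducedIncidence d).map (Int.castRingHom ℝ)) * potentialMatrix a) := by
  have hterm (e : OrderedPair (d + 1)) (s t : Fin d) :
      Polynomial.bezoutMatrix d (∏ j ∈ Finset.univ.erase e.1.1, affineLinForm a j)
        (∏ j ∈ Finset.univ.erase e.1.2, affineLinForm a j) s t =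
      -(minor a e.1.1 e.1.2 *
        ((∏ m ∈ (Finset.univ.erase e.1.1).erase e.1.2, affineLinForm a m).coeff s *
        (∏ m ∈ (Finset.univ.erase e.1.1).erase e.1.2, affineLinForm a m).coeff t)) := by
    rw [← Finset.mul_prod_erase (Finset.univ.erase e.1.1) _ (a := e.1.2) (by simp [e.2.ne']),
      ← Finset.mul_prod_erase (Finset.univ.erase e.1.2) _ (a := e.1.1) (by simp [e.2.ne]),
      Finset.erase_right_comm (a := e.1.2), affineLinForm, affineLinForm,
      Polynomial.bezoutMatrix_linear_mul, minor_eq]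
  rw [dehomog_interpForm, dehomog_interpForm, Polynomial.bezoutMatrix_sum_sum, ← Matrix.mul_assoc,
    ← Matrix.mul_assoc, ← Matrix.transpose_mul, Matrix.mul_assoc]
  ext s t
  rw [Matrix.sum_apply, Matrix.neg_apply, Matrix.mul_apply, ← Finset.sum_neg_distrib]
  refine Finset.sum_congr rfl fun e _ ↦ ?_
  rw [Matrix.smul_apply, hterm, Matrix.mul_diagonal, Matrix.transpose_apply,
    reducedIncidence_mul_potentialMatrix, reducedIncidence_mul_potentialMatrix, ← minor_eq c,
    smul_eq_mul]
  have := h _ _ e.2.ne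
  field_simp

/-! ### The tree sum -/

theorem prod_filter_lt_and {n : ℕ} (q : Fin n × Fin n → Prop) [DecidablePred q]
    (f : Fin n × Fin n → ℝ) :
    ∏ e : Fin n × Fin n with e.1 < e.2 ∧ q e, f e = ∏ e : OrderedPair n with q e.1, f e.1 := by
  refine (Finset.prod_nbij (fun e : OrderedPair n ↦ e.1) ?_ ?_ ?_ fun _ _ ↦ rfl).symm
  · intro e he
    simpa [e.2] using he
  · exact Subtype.val_injective.injOn
  · intro e he
    simp only [Finset.coe_filter, Finset.mem_univ, true_and, Set.mem_ofPred_eq] at he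
    exact ⟨⟨e, he.1⟩, by simpa using he.2, rfl⟩

/-- Clearing the denominators of the edge weights moves the minors of `a` from the edges of each
tree to those of its complement. -/
theorem prod_sq_mul_sum_isTree {n : ℕ} (a c : Matrix (Fin 2) (Fin n) ℝ)
    (h : ∀ i j, i ≠ j → minor a i j ≠ 0) :
    (∏ e : OrderedPair n, minor a e.1.1 e.1.2) ^ 2 *
      (open Classical in ∑ T : SimpleGraph (Fin n) with T.IsTree,
        ∏ e ∈ T.orderedPairs, minor c e.1.1 e.1.2 / minor a e.1.1 e.1.2) =
      (∏ e : OrderedPair n, minor a e.1.1 e.1.2) * spanningTreeSum c a := by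
  classical
  rw [sq, mul_assoc, spanningTreeSum, Finset.mul_sum]
  congr 1
  refine Finset.sum_congr (by congr) fun T _ ↦ ?_
  rw [prod_filter_lt_and fun e ↦ T.Adj e.1 e.2, prod_filter_lt_and fun e ↦ ¬ T.Adj e.1 e.2,
    ← Finset.prod_filter_mul_prod_filter_not Finset.univ
      (fun e : OrderedPair n ↦ T.Adj e.1.1 e.1.2), SimpleGraph.orderedPairs, mul_right_comm]
  congr 1
  rw [← Finset.prod_mul_distrib]
  refine Finset.prod_congr (by congr) fun e _ ↦ ?_
  rw [mul_div_cancel₀]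
  exact h _ _ e.2.ne

theorem corollary4p4 (n : ℕ) (hn : 1 ≤ n) (a : Matrix (Fin 2) (Fin n) ℝ)
    -- the root of each linear form, and these roots are distinct
    (r : Fin n → ℙ ℝ (Fin 2 → ℝ)) (hr : Function.Injective r)
    (hroot : ∀ j p, IsProjRoot (linForm a j) p ↔ p = r j) :
    (∀ F G : MvPolynomial (Fin 2) ℝ, F.IsHomogeneous (n - 1) → G.IsHomogeneous (n - 1) →
      ∃! c : Matrix (Fin 2) (Fin n) ℝ, F = interpForm a (c 0) ∧ G = interpForm a (c 1)) ∧
    -- the normalizing constant of the resultant in these coordinates is non-zero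
    (∏ e : Fin n × Fin n with e.1 < e.2, minor a e.1 e.2) ≠ 0 ∧
    ∀ c : Matrix (Fin 2) (Fin n) ℝ,
      formResultant (interpForm a (c 0)) (interpForm a (c 1)) (n - 1) (n - 1) =
        (-1) ^ n.choose 2 * (∏ e : Fin n × Fin n with e.1 < e.2, minor a e.1 e.2) *
          spanningTreeSum c a := by
  have h (i j : Fin n) (hij : i ≠ j) : minor a i j ≠ 0 := minor_ne_zero hr hroot hij
  refine ⟨fun F G hF hG ↦ ?_, ?_, fun c ↦ ?_⟩
  · obtain ⟨c, hc, hc'⟩ := existsUnique_eq_interpForm hn a h hF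
    obtain ⟨b, hb, hb'⟩ := existsUnique_eq_interpForm hn a h hG
    refine ⟨.of ![c, b], ⟨hc, hb⟩, fun m hm ↦ ?_⟩
    ext i j
    fin_cases i
    · exact congrFun (hc' _ hm.1) j
    · exact congrFun (hb' _ hm.2) j
  · exact Finset.prod_ne_zero_iff.2 fun e he ↦ h _ _ (Finset.mem_filter.1 he).2.ne
  · have hP : ∏ e : Fin n × Fin n with e.1 < e.2, minor a e.1 e.2 =
        ∏ e : OrderedPair n, minor a e.1.1 e.1.2 :=
      Finset.prod_subtype _ (by simp) _
    rw [hP, mul_assoc, ← prod_sq_mul_sum_isTree a c h]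
    obtain ⟨d, rfl⟩ : ∃ d, n = d + 1 := ⟨n - 1, by omega⟩
    have hdeg (b : Fin (d + 1) → ℝ) : (dehomog (interpForm a b)).natDegree ≤ d := by
      rw [dehomog_interpForm]
      refine Polynomial.natDegree_sum_le_of_forall_le _ _ fun i _ ↦
        (Polynomial.natDegree_C_mul_le _ _).trans ?_
      simpa [Finset.card_erase_of_mem] using
        natDegree_prod_affineLinForm_le a (Finset.univ.erase i)
    rw [formResultant, Nat.add_sub_cancel,
      Polynomial.resultant_eq_det_bezoutMatrix d _ _ (hdeg _) (hdeg _),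
      bezoutMatrix_dehomog_interpForm a c h, Matrix.det_neg, Fintype.card_fin, Matrix.det_mul,
      Matrix.det_mul, Matrix.det_transpose, det_reducedLaplacian, ← det_potentialMatrix_sq a h,
      Nat.choose_succ_succ' d 1, Nat.choose_one_right, pow_add]
    ring
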